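/- Let $d,M,K$ be natural numbers with $1\le K\le M$, and consider $M$ arms; arm $m$ returns i.i.d. samples from the Gaussian law on $\mathbb R^d$ with unknown mean $\mu_m$ and identity covariance. Write $\mu=(\mu_1,\dots,\mu_M)\in\mathbb R^{d\times M}$ and $d_{i,j}(\mu)=\|\mu_i-\mu_j\|^2$. Let $\mathcal C:\mathbb R^{d\times M}\to[K]^M$ be a map that sends $\mu$ to the cluster index vector obtained by single-linkage clustering (start from singletons and repeatedly merge two clusters at smallest minimum distance until $K$ clusters remain; ties and labels are resolved arbitrarily), and write $c\sim c'$ if $c=\sigma(c')$ for a permutation $\sigma$ of $[K]$. Suppose that $\mu$ is separated: with $D_k=\{m:\mathcal C(\mu)_m=k\}$, $$\max_{k}\ \max_{\emptyset\ne P\subsetneq D_k}\ \min_{i\in P,\,j\in D_k\setminus P} d_{i,j}(\mu)\;<\;\min_{p\neq q}\ \min_{i\in D_p,\,j\in D_q} d_{i,j}(\mu)$$ ($\max\emptyset=-\infty$, $\min\emptyset=+\infty$). For $\lambda\in\mathbb R^{d\times M}$ and $w$ in the probability simplex $\mathcal P_M$ let $\mathrm{Alt}(\lambda)=\{\lambda':\mathcal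 C(\lambda')\nsim\mathcal C(\lambda)\}$ and $$\psi(w,\lambda)=\inf_{\lambda'\in\mathrm{Alt}(\lambda)}\tfrac12\sum_{m=1}^M w_m\|\lambda'_m-\lambda_m\|^2\in[0,\infty],\qquad \inf\emptyset=\infty .$$ The ATBOC algorithm with parameter $\delta\in(0,1)$ pulls arms $A_1,A_2,\dots$, each chosen from the past observations (and possibly independent randomization). Let $N_m(t)$ be the number of pulls of arm $m$ among the first $t$, $\hat\mu_m(t)$ the empirical mean of the samples of arm $m$ among them ($0$ if there are none), and for $t\ge1$ let $w(t)\in\arg\max_{w\in\mathcal P_M}\psi(w,\hat\mu(t))$. The first arm $A_1$ is arbitrary. For $t\ge1$, if $\min_m N_m(t)<\sqrt{t/M}$, then $A_{t+1}\in\arg\min_m N_m(t)$; otherwise $$A_{t+1}\in\arg\min_{m\in\operatorname{supp}(\sum_{s=1}^t w(s))}\Big[\frac{N_m(t)}t-\frac1t\sum_{s=1}^t w_m(s)\Big].$$ Ties in all minima and maxima are resolved arbitrarily. The algorithm stops at $$\tau_\delta=\inf\Big\{t\ge1:\ t\,\psi\Big(\frac{N(t)}t,\hat\mu(t)\Big)\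 \ge\ \beta(\delta,t)\Big\},\qquad \beta(\delta,t)=2\log\left(\frac{\sqrt{\prod_{m=1}^M (N_m(t)+1)^d}}{\delta}\right),$$ and outputs $\mathcal C(\hat\mu(\tau_\delta))$. Then $$\mathbb P_\mu[\tau_\delta<\infty]=1\qquad\text{and}\qquad \mathbb P_\mu\big[\mathcal C(\hat\mu(\tau_\delta))\nsim\mathcal C(\mu)\big]\le\delta .$$ -/

import Mathlib

open MeasureTheory ProbabilityTheory
open scoped ENNReal

noncomputable section

namespace BanditClustering

/-- A problem instance: the mean vectors of `M` arms in `ℝ^d` (Euclidean norm). -/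
abbrev Means (d M : ℕ) : Type := Fin M → EuclideanSpace ℝ (Fin d)

/-! ### Distances between arms and clusters -/

/-- The distance `d_{i,j}(μ) = ‖μ_i - μ_j‖²` between two arms. -/
def armDist {d M : ℕ} (μ : Means d M) (i j : Fin M) : ℝ := ‖μ i - μ j‖ ^ 2

/-- The minimum distance between a member of `P` and a member of `Q`
(a minimum over a finite set; `+∞` if one of the sets is empty). -/
def linkDist {d M : ℕ} (μ : Means d M) (P Q : Finset (Fin M)) : EReal :=
  ⨅ i ∈ P, ⨅ j ∈ Q, (armDist μ i j : EReal)

/-- The set `D_k` of the arms that carry the label `k`. -/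
def cluster {M K : ℕ} (c : Fin M → Fin K) (k : Fin K) : Finset (Fin M) :=
  Finset.univ.filter fun m => c m = k

/-- The minimum inter-cluster distance of the clustering `c`. -/
def dInter {d M K : ℕ} (μ : Means d M) (c : Fin M → Fin K) : EReal :=
  ⨅ (p : Fin K) (q : Fin K) (_ : p ≠ q), linkDist μ (cluster c p) (cluster c q)

/-- The maximum intra-cluster neighbour distance of the clustering `c`: the maximum over the
clusters `D_k` and over the splittings of `D_k` into two non-empty parts `P₁`, `D_k \ P₁` of the
minimum distance between the two parts. It is `-∞` if no cluster has two members. -/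
def dIntra {d M K : ℕ} (μ : Means d M) (c : Fin M → Fin K) : EReal :=
  ⨆ (k : Fin K) (P₁ : Finset (Fin M)) (_ : P₁ ⊆ cluster c k) (_ : P₁ ≠ ∅)
    (_ : P₁ ≠ cluster c k), linkDist μ P₁ (cluster c k \ P₁)

/-! ### Single-linkage clustering -/

/-- The partitions of the arms that single-linkage clustering can reach: it starts with the
singletons, and each step merges two distinct clusters whose minimum distance is the smallest
(any such pair in case of a tie). -/
inductive SlinkStage {d M : ℕ} (μ : Means d M) : Finset (Finset (Fin M)) → Prop
  | init : SlinkStage μ (Finset.univ.image fun m => {m})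
  | merge {S : Finset (Finset (Fin M))} {P Q : Finset (Fin M)} (h : SlinkStage μ S)
      (hP : P ∈ S) (hQ : Q ∈ S) (hPQ : P ≠ Q)
      (hmin : ∀ P' ∈ S, ∀ Q' ∈ S, P' ≠ Q' → linkDist μ P Q ≤ linkDist μ P' Q') :
      SlinkStage μ (insert (P ∪ Q) ((S.erase P).erase Q))

/-- `C` computes cluster index vectors by single linkage stopped at `K` clusters: for every `μ` the
classes of the labelling `C μ` are the `K` clusters of a run of single linkage on `μ`. Ties, and the
numbering of the clusters, are resolved by `C` in an arbitrary way. -/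
def IsSlinkMap {d M K : ℕ} (C : Means d M → Fin M → Fin K) : Prop :=
  ∀ μ, ∃ S, SlinkStage μ S ∧ S.card = K ∧ Finset.univ.image (cluster (C μ)) = S

/-- Two cluster index vectors are equivalent if they agree up to a permutation of the labels. -/
def Equivalent {M K : ℕ} (c₁ c₂ : Fin M → Fin K) : Prop :=
  ∃ σ : Equiv.Perm (Fin K), c₁ = fun m => σ (c₂ m)

/-! ### The inner infimum and the optimal proportions -/

/-- The alternative instances, those with a clustering not equivalent to that of `μ`. -/
def Alt {d M K : ℕ} (C : Means d M → Fin M → Fin K) (μ : Means d M) : Set (Means d M) :=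
  {l | ¬ Equivalent (C l) (C μ)}

/-- `ψ(w, μ) = inf_{l ∈ Alt(μ)} (1/2) ∑ₘ wₘ ‖lₘ - μₘ‖²`, in `[0, ∞]` (the weights are
nonnegative). It is `∞` exactly when there is no alternative. -/
def psi {d M K : ℕ} (C : Means d M → Fin M → Fin K) (w : Fin M → ℝ) (μ : Means d M) : ℝ≥0∞ :=
  ⨅ l ∈ Alt C μ, ENNReal.ofReal (1 / 2 * ∑ m, w m * ‖l m - μ m‖ ^ 2)

/-- The set `argmax_w ψ(w, μ)` of optimal proportions, `w` ranging over the probability simplex. -/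
def optimalProportions {d M K : ℕ} (C : Means d M → Fin M → Fin K) (μ : Means d M) :
    Set (Fin M → ℝ) :=
  {w | w ∈ stdSimplex ℝ (Fin M) ∧ ∀ w' ∈ stdSimplex ℝ (Fin M), psi C w' μ ≤ psi C w μ}

/-! ### The ATBOC algorithm along one sequence of pulls

`a t` is the arm pulled in round `t + 1` and `x t` is the sample that it returns. -/

/-- `N_m(t)`: the number of times that arm `m` is pulled in the first `t` rounds. -/
def pulls {M : ℕ} (a : ℕ → Fin M) (t : ℕ) (m : Fin M) : ℕ :=
  ((Finset.range t).filter fun s => a s = m).card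

/-- The empirical means after `t` rounds (`0` for an arm that has not been pulled yet). -/
def empMean {d M : ℕ} (a : ℕ → Fin M) (x : ℕ → EuclideanSpace ℝ (Fin d)) (t : ℕ) : Means d M :=
  fun m => (pulls a t m : ℝ)⁻¹ • ∑ s ∈ (Finset.range t).filter (fun s => a s = m), x s

/-- The statistic `Z(t) = t ψ(N(t)/t, μ̂(t))`. -/
def glr {d M K : ℕ} (C : Means d M → Fin M → Fin K) (a : ℕ → Fin M)
    (x : ℕ → EuclideanSpace ℝ (Fin d)) (t : ℕ) : ℝ≥0∞ :=
  (t : ℝ≥0∞) * psi C (fun m => (pulls a t m : ℝ) / t) (empMean a x t)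

/-- The threshold `β(δ, t) = 2 log (√(∏ₘ (N_m(t) + 1)^d) / δ)`. -/
def threshold {M : ℕ} (d : ℕ) (δ : ℝ) (a : ℕ → Fin M) (t : ℕ) : ℝ :=
  2 * Real.log (√(∏ m, ((pulls a t m : ℝ) + 1) ^ d) / δ)

/-- The stopping time: the first `t ≥ 1` with `Z(t) ≥ β(δ, t)`, and `⊤` if there is none. -/
def stopTime {d M K : ℕ} (C : Means d M → Fin M → Fin K) (δ : ℝ) (a : ℕ → Fin M)
    (x : ℕ → EuclideanSpace ℝ (Fin d)) : ℕ∞ :=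
  ⨅ (t : ℕ) (_ : 1 ≤ t ∧ ENNReal.ofReal (threshold d δ a t) ≤ glr C a x t), (t : ℕ∞)

/-- The pulls `a`, the samples `x` and the weights `w` follow the ATBOC sampling rule. Ties in the
minima and in the choice of the weights are resolved in an arbitrary way. Nothing is asked of the
first pull `a 0`, before which all counts are `0` and no weights exist. -/
structure FollowsATBOC {d M K : ℕ} (C : Means d M → Fin M → Fin K) (a : ℕ → Fin M)
    (x : ℕ → EuclideanSpace ℝ (Fin d)) (w : ℕ → Fin M → ℝ) : Prop where
  /-- The weights are plug-in optimal proportions. -/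
  weights : ∀ t, 1 ≤ t → w t ∈ optimalProportions C (empMean a x t)
  /-- Forced exploration: if `min_m N_m(t) < √(t / M)`, pull an arm with the fewest pulls. -/
  explore : ∀ t : ℕ, 1 ≤ t → (∃ m, (pulls a t m : ℝ) < √((t : ℝ) / M)) →
    ∀ m, pulls a t (a t) ≤ pulls a t m
  /-- Otherwise track the average of the weights `w 1, …, w t` on the support of their sum. -/
  track : ∀ t : ℕ, 1 ≤ t → (¬ ∃ m, (pulls a t m : ℝ) < √((t : ℝ) / M)) →
    (∑ s ∈ Finset.Icc 1 t, w s (a t) ≠ 0) ∧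
    ∀ m, (∑ s ∈ Finset.Icc 1 t, w s m ≠ 0) →
      (pulls a t (a t) : ℝ) / t - 1 / t * ∑ s ∈ Finset.Icc 1 t, w s (a t) ≤
        (pulls a t m : ℝ) / t - 1 / t * ∑ s ∈ Finset.Icc 1 t, w s m

/-! ### The bandit model -/

/-- The law of the observations of a sequential sampling procedure on the instance `μ`: the arm
`A t` is chosen from the information `ℱ t` available after `t` rounds (past samples and possibly
independent randomization), and given `ℱ t` the sample `X t` is Gaussian with mean `μ (A t)` and
identity covariance, i.e. `X t - μ (A t)` is standard Gaussian and independent of `ℱ t`. -/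
structure IsGaussianBandit {d M : ℕ} {Ω : Type*} [mΩ : MeasurableSpace Ω] (P : Measure Ω)
    (μ : Means d M) (ℱ : Filtration ℕ mΩ) (A : ℕ → Ω → Fin M)
    (X : ℕ → Ω → EuclideanSpace ℝ (Fin d)) : Prop where
  measurable_arm : ∀ t, Measurable[ℱ t] (A t)
  measurable_sample : ∀ t, Measurable[ℱ (t + 1)] (X t)
  map_noise : ∀ t,
    P.map (fun ω => X t ω - μ (A t ω)) = stdGaussian (EuclideanSpace ℝ (Fin d))
  indep_noise : ∀ t,
    Indep (MeasurableSpace.comap (fun ω => X t ω - μ (A t ω)) inferInstance) (ℱ t) P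

end BanditClustering

end

namespace BanditClustering

/-! ### Single linkage on separated instances -/

/-! Two facts carry the proof.

Stability: a real `r` separates the intra-cluster neighbour distances from the inter-cluster ones.
This amounts to finitely many strict inequalities, so it persists near `μ`, and there single linkage
returns the same classes (`IsSlinkMap.eventually_equivalent`). Alternatives to an instance near `μ`
are thus at a distance bounded below, and `psi C w` is at least a constant times the smallest weight
(`IsSlinkMap.exists_le_psi`).

Concentration: averaging likelihood ratios against `μ` over a standard Gaussian perturbation of each
mean gives a nonnegative martingale `mixture` with initial value 1, under any adaptive choice of
arms. Ville's inequality bounds by `δ` the probability that it ever reaches `δ⁻¹`, and shows that it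
is almost surely bounded.

Error: if the output is wrong, `μ` is an alternative to the empirical mean, and the stopping
condition forces `mixture` up to `δ⁻¹` (`inv_le_mixture_of_not_equivalent`).

Termination: where `mixture` is bounded by `b`, each squared estimation error is `O(log t /
N_m(t))`. Forced exploration gives `N_m(t) ≥ √(t / (2M)) - 1`, so the estimates enter the stable
neighbourhood, and there the statistic is at least of order `√t`, against a threshold of order `log
t`. -/

lemma linkDist_le {d M : ℕ} (μ : Means d M) {P Q : Finset (Fin M)} {i j : Fin M}
    (hi : i ∈ P) (hj : j ∈ Q) : linkDist μ P Q ≤ (armDist μ i j : EReal) :=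
  iInf₂_le_of_le i hi (iInf₂_le j hj)

lemma exists_armDist_lt_of_linkDist_lt {d M : ℕ} {μ : Means d M} {P Q : Finset (Fin M)} {r : ℝ}
    (h : linkDist μ P Q < (r : EReal)) : ∃ i ∈ P, ∃ j ∈ Q, armDist μ i j < r := by
  simp only [linkDist, iInf_lt_iff, EReal.coe_lt_coe_iff] at h
  obtain ⟨i, hi, j, hj, h⟩ := h
  exact ⟨i, hi, j, hj, h⟩

/-- The threshold `r` lies strictly between the intra-cluster neighbour distances and the
inter-cluster distances of `c`. -/
structure SeparatedAt {d M K : ℕ} (μ : Means d M) (c : Fin M → Fin K) (r : ℝ) : Prop where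
  inner : ∀ (k : Fin K) (Q : Finset (Fin M)), Q ⊆ cluster c k → Q ≠ ∅ → Q ≠ cluster c k →
    ∃ i ∈ Q, ∃ j ∈ cluster c k \ Q, armDist μ i j < r
  outer : ∀ i j, c i ≠ c j → r < armDist μ i j

lemma mem_cluster {M K : ℕ} {c : Fin M → Fin K} {k : Fin K} {m : Fin M} :
    m ∈ cluster c k ↔ c m = k := by simp [cluster]

lemma exists_separatedAt {d M K : ℕ} {μ : Means d M} {c : Fin M → Fin K}
    (h : dIntra μ c < dInter μ c) : ∃ r, SeparatedAt μ c r := by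
  -- A real number lies in between even if `dIntra` is `-∞` or `dInter` is `+∞`, so these cases need
  -- no separate treatment.
  obtain ⟨r, h₁, h₂⟩ := EReal.lt_iff_exists_real_btwn.1 h
  refine ⟨r, ⟨fun k Q hQ hne hne' => ?_, fun i j hij => ?_⟩⟩
  · refine exists_armDist_lt_of_linkDist_lt (lt_of_le_of_lt ?_ h₁)
    exact le_iSup_of_le k <| le_iSup_of_le Q <| le_iSup_of_le hQ <| le_iSup_of_le hne <|
      le_iSup_of_le hne' le_rfl
  · rw [← EReal.coe_lt_coe_iff]
    refine h₂.trans_le ?_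
    refine iInf_le_of_le (c i) <| iInf_le_of_le (c j) <| iInf_le_of_le hij ?_
    exact linkDist_le μ (mem_cluster.2 rfl) (mem_cluster.2 rfl)

lemma continuous_armDist {d M : ℕ} (i j : Fin M) :
    Continuous fun μ : Means d M => armDist μ i j := by
  unfold armDist; fun_prop

lemma SeparatedAt.eventually {d M K : ℕ} {μ : Means d M} {c : Fin M → Fin K} {r : ℝ}
    (h : SeparatedAt μ c r) : ∀ᶠ l in nhds μ, SeparatedAt l c r := by
  have h₁ : ∀ᶠ l in nhds μ, ∀ (k : Fin K) (Q : Finset (Fin M)), Q ⊆ cluster c k → Q ≠ ∅ →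
      Q ≠ cluster c k → ∃ i ∈ Q, ∃ j ∈ cluster c k \ Q, armDist l i j < r := by
    simp only [Filter.eventually_all]
    intro k Q hQ hne hne'
    obtain ⟨i, hi, j, hj, hij⟩ := h.inner k Q hQ hne hne'
    filter_upwards [(continuous_armDist i j).continuousAt.eventually_lt_const hij] with l hl
    exact ⟨i, hi, j, hj, hl⟩
  have h₂ : ∀ᶠ l in nhds μ, ∀ i j, c i ≠ c j → r < armDist l i j := by
    simp only [Filter.eventually_all]
    intro i j hij
    exact (continuous_armDist i j).continuousAt.eventually_const_lt (h.outer i j hij)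
  filter_upwards [h₁, h₂] with l hl₁ hl₂ using ⟨hl₁, hl₂⟩

/-- As long as at least `K` clusters are left, single linkage refines a separated clustering. -/
lemma SlinkStage.refines {d M K : ℕ} {μ : Means d M} {c : Fin M → Fin K} {r : ℝ}
    (hc : SeparatedAt μ c r) {S : Finset (Finset (Fin M))} (hS : SlinkStage μ S)
    (hK : K ≤ S.card) :
    (∀ Q ∈ S, Q.Nonempty ∧ ∃ k, Q ⊆ cluster c k) ∧ ∀ m, ∃ Q ∈ S, m ∈ Q := by
  induction hS with
  | init =>
    refine ⟨fun Q hQ => ?_, fun m => ⟨{m}, by simp, by simp⟩⟩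
    obtain ⟨m, -, rfl⟩ := Finset.mem_image.1 hQ
    exact ⟨by simp, c m, by simp [mem_cluster]⟩
  | @merge S P Q h hP hQ hPQ hmin ih =>
    -- A merge lowers the number of clusters by at least one, so strictly more than `K` were present
    -- before it.
    have hcard : K < S.card := by
      have h₁ := Finset.card_insert_le (P ∪ Q) ((S.erase P).erase Q)
      have h₂ := Finset.card_erase_of_mem (Finset.mem_erase.2 ⟨hPQ.symm, hQ⟩)
      have h₃ := Finset.card_erase_of_mem hP
      have h₄ : 1 < S.card := Finset.one_lt_card.2 ⟨P, hP, Q, hQ, hPQ⟩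
      omega
    obtain ⟨ih₁, ih₂⟩ := ih hcard.le
    -- Pigeonhole: two of the more than `K` clusters lie in one class, so some cluster `R` is a
    -- proper part of its class. By separation `R` has a neighbour closer than `r` in another
    -- cluster; the minimal link is then below `r` and cannot join two classes.
    have hlab : ∀ R : S, ∃ k, R.1 ⊆ cluster c k := fun R => (ih₁ R.1 R.2).2
    choose lab hlab using hlab
    obtain ⟨P₁, P₂, hne, heq⟩ := Fintype.exists_ne_map_eq_of_card_lt lab (by simpa using hcard)
    have key : ∃ R : S, R.1 ≠ cluster c (lab R) := by
      by_contra! hcon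
      exact hne (Subtype.ext (by rw [hcon P₁, hcon P₂, heq]))
    obtain ⟨R, hR⟩ := key
    obtain ⟨i, hi, j, hj, hij⟩ := hc.inner _ R.1 (hlab R)
      (ih₁ R.1 R.2).1.ne_empty hR
    obtain ⟨R', hR', hjR'⟩ := ih₂ j
    have hRR' : R.1 ≠ R' := fun e => (Finset.mem_sdiff.1 hj).2 (e ▸ hjR')
    have hlt : linkDist μ P Q < (r : EReal) :=
      ((hmin R.1 R.2 R' hR' hRR').trans (linkDist_le μ hi hjR')).trans_lt
        (EReal.coe_lt_coe_iff.2 hij)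
    obtain ⟨i', hi', j', hj', hlt⟩ := exists_armDist_lt_of_linkDist_lt hlt
    obtain ⟨p, hp⟩ := (ih₁ P hP).2
    obtain ⟨q, hq⟩ := (ih₁ Q hQ).2
    have hpq : p = q := by
      rw [← mem_cluster.1 (hp hi'), ← mem_cluster.1 (hq hj')]
      by_contra hne
      exact lt_asymm hlt (hc.outer _ _ hne)
    subst hpq
    refine ⟨fun R hR => ?_, fun m => ?_⟩
    · rcases Finset.mem_insert.1 hR with rfl | hR
      · exact ⟨(ih₁ P hP).1.mono Finset.subset_union_left, p, Finset.union_subset hp hq⟩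
      · exact ih₁ R (Finset.mem_of_mem_erase (Finset.mem_of_mem_erase hR))
    · obtain ⟨R, hR, hm⟩ := ih₂ m
      by_cases hRP : R = P
      · exact ⟨P ∪ Q, by simp, by simp [← hRP, hm]⟩
      by_cases hRQ : R = Q
      · exact ⟨P ∪ Q, by simp, by simp [← hRQ, hm]⟩
      · exact ⟨R, by simp [hR, hRP, hRQ], hm⟩

lemma SlinkStage.nonempty {d M : ℕ} {μ : Means d M} {S : Finset (Finset (Fin M))}
    (hS : SlinkStage μ S) : ∀ Q ∈ S, Q.Nonempty := by
  induction hS with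
  | init => simp
  | @merge S P Q h hP hQ hPQ hmin ih =>
    intro R hR
    rcases Finset.mem_insert.1 hR with rfl | hR
    · exact (ih P hP).mono Finset.subset_union_left
    · exact ih R (Finset.mem_of_mem_erase (Finset.mem_of_mem_erase hR))

lemma IsSlinkMap.surjective {d M K : ℕ} {C : Means d M → Fin M → Fin K} (hC : IsSlinkMap C)
    (μ : Means d M) : Function.Surjective (C μ) := by
  intro k
  obtain ⟨S, hS, -, himg⟩ := hC μ
  obtain ⟨m, hm⟩ := hS.nonempty (cluster (C μ) k)
    (himg ▸ Finset.mem_image_of_mem _ (Finset.mem_univ k))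
  exact ⟨m, mem_cluster.1 hm⟩

lemma Equivalent.symm {M K : ℕ} {c₁ c₂ : Fin M → Fin K} (h : Equivalent c₁ c₂) :
    Equivalent c₂ c₁ := by
  obtain ⟨σ, rfl⟩ := h
  exact ⟨σ.symm, by simp⟩

lemma Equivalent.trans {M K : ℕ} {c₁ c₂ c₃ : Fin M → Fin K} (h : Equivalent c₁ c₂)
    (h' : Equivalent c₂ c₃) : Equivalent c₁ c₃ := by
  obtain ⟨σ, rfl⟩ := h
  obtain ⟨τ, rfl⟩ := h'
  exact ⟨τ.trans σ, rfl⟩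

/-- By refinement `c` factors as `f ∘ C μ`. Surjectivity of `c` makes `f` a surjection of the finite
set `Fin K` onto itself, hence a permutation. -/
lemma IsSlinkMap.equivalent_of_separatedAt {d M K : ℕ} {C : Means d M → Fin M → Fin K}
    (hC : IsSlinkMap C) {μ : Means d M} {c : Fin M → Fin K} {r : ℝ} (hc : SeparatedAt μ c r)
    (hsurj : Function.Surjective c) : Equivalent c (C μ) := by
  obtain ⟨S, hS, hcard, himg⟩ := hC μ
  have href := (hS.refines hc hcard.ge).1
  have hf : ∀ k, ∃ k', cluster (C μ) k ⊆ cluster c k' := fun k =>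
    (href _ (himg ▸ Finset.mem_image_of_mem _ (Finset.mem_univ k))).2
  choose f hf using hf
  have hcf : ∀ m, c m = f (C μ m) := fun m => mem_cluster.1 (hf _ (mem_cluster.2 rfl))
  have hfs : Function.Surjective f := fun k => by
    obtain ⟨m, rfl⟩ := hsurj k
    exact ⟨_, (hcf m).symm⟩
  exact ⟨Equiv.ofBijective f (Finite.surjective_iff_bijective.1 hfs), funext hcf⟩

/-- Near a separated instance, single linkage returns the same clustering. -/
lemma IsSlinkMap.eventually_equivalent {d M K : ℕ} {C : Means d M → Fin M → Fin K}
    (hC : IsSlinkMap C) {μ : Means d M} (hμ : dIntra μ (C μ) < dInter μ (C μ)) :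
    ∀ᶠ l in nhds μ, Equivalent (C μ) (C l) := by
  obtain ⟨r, hr⟩ := exists_separatedAt hμ
  filter_upwards [hr.eventually] with l hl
  exact hC.equivalent_of_separatedAt hl (hC.surjective μ)

/-- The alternatives of all instances near a separated one are uniformly far away. -/
lemma IsSlinkMap.exists_le_psi {d M K : ℕ} {C : Means d M → Fin M → Fin K}
    (hC : IsSlinkMap C) {μ : Means d M} (hμ : dIntra μ (C μ) < dInter μ (C μ)) :
    ∃ ε > 0, ∀ l : Means d M, (∀ m, ‖l m - μ m‖ < ε) → ∀ (w : Fin M → ℝ) (b : ℝ), 0 ≤ b →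
      (∀ m, b ≤ w m) → ENNReal.ofReal (1 / 2 * (b * ε ^ 2)) ≤ psi C w l := by
  obtain ⟨ε, hε, hball⟩ := Metric.eventually_nhds_iff.1 (hC.eventually_equivalent hμ)
  refine ⟨ε / 2, by positivity, fun l hl w b hb hbw => ?_⟩
  have hlμ : dist l μ < ε / 2 := (dist_pi_lt_iff (by positivity)).2 fun m => by
    rw [dist_eq_norm]; exact hl m
  refine le_iInf₂ fun l' hl' => ENNReal.ofReal_le_ofReal ?_
  -- By the triangle inequality, a closer `l'` would lie in the `ε`-ball around `μ`, where all
  -- clusterings are equivalent. The distance is a maximum over arms, so a single arm `m` witnesses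
  -- it.
  have hfar : ¬ dist l' l < ε / 2 := fun hlt => by
    refine hl' ((hball ?_).symm.trans (hball (hlμ.trans (by linarith))))
    linarith [dist_triangle l' l μ]
  rw [dist_pi_lt_iff (by positivity)] at hfar
  push Not at hfar
  obtain ⟨m, hm⟩ := hfar
  rw [dist_eq_norm] at hm
  have h₁ : w m * ‖l' m - l m‖ ^ 2 ≤ ∑ m, w m * ‖l' m - l m‖ ^ 2 :=
    Finset.single_le_sum (f := fun m => w m * ‖l' m - l m‖ ^ 2)
      (fun m _ => mul_nonneg (hb.trans (hbw m)) (by positivity)) (Finset.mem_univ m)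
  have h₂ : b * (ε / 2) ^ 2 ≤ w m * ‖l' m - l m‖ ^ 2 := by
    gcongr
    · exact hb.trans (hbw m)
    · exact hbw m
  linarith

/-! ### Pull counts -/

lemma pulls_succ {M : ℕ} (a : ℕ → Fin M) (t : ℕ) (m : Fin M) :
    pulls a (t + 1) m = pulls a t m + if a t = m then 1 else 0 := by
  unfold pulls
  rw [Finset.range_add_one, Finset.filter_insert]
  split_ifs with h
  · rw [Finset.card_insert_of_notMem (by simp)]
  · simp

lemma pulls_le {M : ℕ} (a : ℕ → Fin M) (t : ℕ) (m : Fin M) : pulls a t m ≤ t :=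
  (Finset.card_filter_le _ _).trans (Finset.card_range t).le

lemma monotone_pulls {M : ℕ} (a : ℕ → Fin M) (m : Fin M) : Monotone fun t => pulls a t m :=
  monotone_nat_of_le_succ fun t => by rw [pulls_succ]; omega

/-- Forced exploration: if, from round `t₀` on, an arm with the fewest pulls is pulled whenever
some arm has at most `k` pulls, then after `M` more rounds each arm has more than `k` pulls. -/
lemma lt_pulls_of_forced {M : ℕ} {a : ℕ → Fin M} {k t₀ : ℕ}
    (h : ∀ t, t₀ ≤ t → (∃ m, pulls a t m ≤ k) → ∀ m, pulls a t (a t) ≤ pulls a t m)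
    (hk : ∀ m, k ≤ pulls a t₀ m) (m : Fin M) : k < pulls a (t₀ + M) m := by
  -- Each round removes an arm from the set of those with at most `k` pulls: the pulled arm has
  -- exactly `k`, at most by minimality and at least by `hk`.
  have key : ∀ n, (Finset.univ.filter fun m => pulls a (t₀ + n) m ≤ k).card ≤ M - n := by
    intro n
    induction n with
    | zero => simpa using Finset.card_le_univ (Finset.univ.filter fun m => pulls a t₀ m ≤ k)
    | succ n ih =>
      by_cases hex : ∃ m, pulls a (t₀ + n) m ≤ k
      · have hlt : (Finset.univ.filter fun m => pulls a (t₀ + (n + 1)) m ≤ k).card <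
            (Finset.univ.filter fun m => pulls a (t₀ + n) m ≤ k).card := by
          refine Finset.card_lt_card (Finset.ssubset_iff_subset_ne.2 ⟨fun m hm => ?_, fun heq => ?_⟩)
          · simp only [Finset.mem_filter_univ] at hm ⊢
            exact (monotone_pulls a m (by omega)).trans hm
          · obtain ⟨m, hm⟩ := hex
            have h₁ : pulls a (t₀ + n) (a (t₀ + n)) ≤ k :=
              (h _ (by omega) ⟨m, hm⟩ m).trans hm
            have h₂ : k ≤ pulls a (t₀ + n) (a (t₀ + n)) :=
              (hk _).trans (monotone_pulls a _ (by omega))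
            have h₃ : a (t₀ + n) ∈ Finset.univ.filter fun m => pulls a (t₀ + n) m ≤ k := by
              simpa using h₁
            rw [← heq] at h₃
            simp only [Finset.mem_filter_univ, ← add_assoc, pulls_succ, if_true] at h₃
            omega
        omega
      · push Not at hex
        rw [Finset.filter_false_of_mem]
        · simp
        · intro m _ hm
          exact absurd ((monotone_pulls a m (by omega)).trans hm) (hex m).not_ge
  have h0 := key M
  simp only [Nat.sub_self, Nat.le_zero, Finset.card_eq_zero, Finset.filter_eq_empty_iff] at h0
  simpa using h0 (Finset.mem_univ m)

/-- Under the ATBOC sampling rule the pulls of each arm grow at least like the square root of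
the number of rounds. -/
lemma FollowsATBOC.le_pulls {d M K : ℕ} {C : Means d M → Fin M → Fin K} {a : ℕ → Fin M}
    {x : ℕ → EuclideanSpace ℝ (Fin d)} {w : ℕ → Fin M → ℝ} (h : FollowsATBOC C a x w) (m : Fin M)
    {k t : ℕ} (ht : 2 * M * k ^ 2 ≤ t) : k ≤ pulls a t m := by
  have hM : 0 < M := Fin.pos m
  induction k generalizing t m with
  | zero => exact Nat.zero_le _
  | succ k ih =>
    -- From this round on `k < √(t / M)`, so exploration is forced while some arm has at most `k`
    -- pulls. The `+ 1` skips the arbitrary first pull when `k = 0`; the `M` further rounds fit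
    -- since `2Mk² + 1 + M ≤ 2M(k + 1)²`.
    have hlt := lt_pulls_of_forced (a := a) (k := k) (t₀ := 2 * M * k ^ 2 + 1) (fun t ht hex => by
      obtain ⟨m, hm⟩ := hex
      refine h.explore t (by omega) ⟨m, lt_of_le_of_lt (Nat.cast_le.2 hm) ?_⟩
      rw [Real.lt_sqrt (by positivity), lt_div_iff₀ (by positivity)]
      have : k ^ 2 * M < t := by nlinarith
      exact_mod_cast this) (fun m => ih m (by omega)) m
    have hmono := monotone_pulls a m (show 2 * M * k ^ 2 + 1 + M ≤ t by nlinarith)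
    exact hlt.trans_le hmono

/-! ### A Gaussian integral -/

/-- Completing the square. The right side is the Bayesian predictive density of the next noise term
under a standard Gaussian prior, after `a - 1` observations with sum `s`. -/
lemma gaussianPDFReal_mul_ratio {a : ℝ} (ha : 0 < a) (s z : ℝ) :
    gaussianPDFReal 0 1 z *
        (√(a / (a + 1)) * Real.exp ((s + z) ^ 2 / (2 * (a + 1)) - s ^ 2 / (2 * a))) =
      gaussianPDFReal (s / a) ((a + 1) / a).toNNReal z := by
  have ha' : 0 < a + 1 := by linarith
  have hv : (((a + 1) / a).toNNReal : ℝ) = (a + 1) / a := Real.coe_toNNReal _ (by positivity)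
  simp only [gaussianPDFReal, hv, NNReal.coe_one, mul_one, sub_zero]
  rw [mul_mul_mul_comm, ← Real.exp_add]
  congr 1
  · rw [Real.sqrt_mul (by positivity) ((a + 1) / a), mul_inv, ← Real.sqrt_inv ((a + 1) / a),
      inv_div]
  · congr 1
    field_simp
    ring

lemma lintegral_ratio_gaussianReal {a : ℝ} (ha : 0 < a) (s : ℝ) :
    ∫⁻ z, ENNReal.ofReal
        (√(a / (a + 1)) * Real.exp ((s + z) ^ 2 / (2 * (a + 1)) - s ^ 2 / (2 * a)))
      ∂gaussianReal 0 1 = 1 := by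
  have hv : ((a + 1) / a).toNNReal ≠ 0 := by
    have : 0 < (a + 1) / a := by positivity
    simpa using this
  rw [gaussianReal_of_var_ne_zero _ one_ne_zero,
    lintegral_withDensity_eq_lintegral_mul _ (measurable_gaussianPDF 0 1) (by fun_prop),
    ← lintegral_gaussianPDF_eq_one (s / a) hv]
  refine lintegral_congr fun z => ?_
  simp only [Pi.mul_apply, gaussianPDF]
  rw [← ENNReal.ofReal_mul (gaussianPDFReal_nonneg _ _ _), gaussianPDFReal_mul_ratio ha]

/-- The factor by which the Gaussian mixture likelihood ratio of an arm grows when the noise `z`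
is added to `a - 1` observations with noise sum `s`. -/
noncomputable def mixtureRatio {d : ℕ} (a : ℝ) (s z : EuclideanSpace ℝ (Fin d)) : ℝ :=
  √(a / (a + 1)) ^ d * Real.exp (‖s + z‖ ^ 2 / (2 * (a + 1)) - ‖s‖ ^ 2 / (2 * a))

/-- Both the standard Gaussian and the ratio factor over coordinates, which reduces the integral to
dimension one. -/
lemma lintegral_mixtureRatio {d : ℕ} {a : ℝ} (ha : 0 < a) (s : EuclideanSpace ℝ (Fin d)) :
    ∫⁻ z, ENNReal.ofReal (mixtureRatio a s z) ∂stdGaussian (EuclideanSpace ℝ (Fin d)) = 1 := by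
  rw [← map_pi_eq_stdGaussian, lintegral_map (by unfold mixtureRatio; fun_prop) (by fun_prop)]
  have h : ∀ z : Fin d → ℝ, ENNReal.ofReal (mixtureRatio a s (WithLp.toLp 2 z)) =
      ∏ i, ENNReal.ofReal (√(a / (a + 1)) *
        Real.exp ((s i + z i) ^ 2 / (2 * (a + 1)) - (s i) ^ 2 / (2 * a))) := fun z => by
    rw [← ENNReal.ofReal_prod_of_nonneg (fun i _ => by positivity), mixtureRatio,
      Finset.prod_mul_distrib, ← Real.exp_sum, Finset.prod_const, Finset.card_univ,
      Fintype.card_fin, Finset.sum_sub_distrib, ← Finset.sum_div, ← Finset.sum_div,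
      EuclideanSpace.real_norm_sq_eq, EuclideanSpace.real_norm_sq_eq]
    simp
  simp_rw [h]
  rw [lintegral_prod_eq_prod_lintegral_of_indepFun Finset.univ
    (fun i (z : Fin d → ℝ) => ENNReal.ofReal (√(a / (a + 1)) *
      Real.exp ((s i + z i) ^ 2 / (2 * (a + 1)) - (s i) ^ 2 / (2 * a))))
    (iIndepFun_pi (X := fun i z => ENNReal.ofReal (√(a / (a + 1)) *
      Real.exp ((s i + z) ^ 2 / (2 * (a + 1)) - (s i) ^ 2 / (2 * a))))
      fun i => Measurable.aemeasurable (by fun_prop)) (fun i => by fun_prop)]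
  refine Finset.prod_eq_one fun i _ => ?_
  rw [← lintegral_ratio_gaussianReal ha (s i),
    ← (measurePreserving_eval (fun _ : Fin d => gaussianReal 0 1) i).lintegral_comp (by fun_prop)]

/-! ### Ville's inequality -/

/-- Ville's inequality for nonnegative supermartingales with values in `[0, ∞]`. -/
lemma ville {Ω : Type*} [mΩ : MeasurableSpace Ω] (P : Measure Ω) (ℱ : Filtration ℕ mΩ)
    (Z : ℕ → Ω → ℝ≥0∞) (hZ : ∀ t, Measurable[ℱ t] (Z t))
    (hsuper : ∀ t B, MeasurableSet[ℱ t] B → ∫⁻ ω in B, Z (t + 1) ω ∂P ≤ ∫⁻ ω in B, Z t ω ∂P)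
    (c : ℝ≥0∞) : c * P {ω | ∃ t, c ≤ Z t ω} ≤ ∫⁻ ω, Z 0 ω ∂P := by
  have hset : ∀ n, MeasurableSet[ℱ n] {ω | ∃ t ≤ n, c ≤ Z t ω} := fun n => by
    have : {ω | ∃ t ≤ n, c ≤ Z t ω} = ⋃ t ∈ Finset.range (n + 1), {ω | c ≤ Z t ω} := by
      ext ω; simp
    rw [this]
    refine Finset.measurableSet_biUnion _ fun t ht => ?_
    exact ℱ.mono (Nat.lt_succ_iff.1 (Finset.mem_range.1 ht)) _
      (measurableSet_le measurable_const (hZ t))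
  have hstep : ∀ (B : Set Ω) n, MeasurableSet B → c * P (B ∩ {ω | c ≤ Z n ω}) +
      ∫⁻ ω in B \ {ω | c ≤ Z n ω}, Z n ω ∂P ≤ ∫⁻ ω in B, Z n ω ∂P := fun B n hB => by
    have hm : MeasurableSet {ω | c ≤ Z n ω} :=
      ℱ.le n _ (measurableSet_le measurable_const (hZ n))
    rw [← lintegral_inter_add_sdiff (fun ω => Z n ω) B hm]
    gcongr
    rw [← setLIntegral_const]
    exact setLIntegral_mono ((hZ n).mono (ℱ.le n) le_rfl) fun ω hω => hω.2
  -- Keeping the integral over the paths that have not yet crossed is what closes the induction: it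
  -- pays for the next crossings.
  have key : ∀ n, c * P {ω | ∃ t ≤ n, c ≤ Z t ω} +
      ∫⁻ ω in {ω | ∃ t ≤ n, c ≤ Z t ω}ᶜ, Z n ω ∂P ≤ ∫⁻ ω, Z 0 ω ∂P := by
    intro n
    induction n with
    | zero => simpa [Set.compl_eq_univ_sdiff] using hstep Set.univ 0 MeasurableSet.univ
    | succ n ih =>
      set E := {ω | ∃ t ≤ n, c ≤ Z t ω} with hE
      have hsucc : {ω | ∃ t ≤ n + 1, c ≤ Z t ω} = E ∪ Eᶜ ∩ {ω | c ≤ Z (n + 1) ω} := by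
        rw [Set.union_inter_distrib_left, Set.union_compl_self, Set.univ_inter]
        ext ω
        simp only [hE, Set.mem_ofPred_eq, Set.mem_union, Nat.le_succ_iff_eq_or_le]
        constructor
        · rintro ⟨t, rfl | ht, h⟩
          exacts [Or.inr h, Or.inl ⟨t, ht, h⟩]
        · rintro (⟨t, ht, h⟩ | h)
          exacts [⟨t, Or.inr ht, h⟩, ⟨n + 1, Or.inl rfl, h⟩]
      have hcompl : (E ∪ Eᶜ ∩ {ω | c ≤ Z (n + 1) ω})ᶜ = Eᶜ \ {ω | c ≤ Z (n + 1) ω} := by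
        ext ω; simp only [Set.mem_compl_iff, Set.mem_union, Set.mem_inter_iff, Set.mem_sdiff]; tauto
      rw [hsucc, hcompl]
      calc _ ≤ c * P E + (c * P (Eᶜ ∩ {ω | c ≤ Z (n + 1) ω}) +
            ∫⁻ ω in Eᶜ \ {ω | c ≤ Z (n + 1) ω}, Z (n + 1) ω ∂P) := by
            rw [← add_assoc, ← mul_add]; gcongr; exact measure_union_le _ _
        _ ≤ c * P E + ∫⁻ ω in Eᶜ, Z (n + 1) ω ∂P := by
            gcongr; exact hstep _ _ (ℱ.le n _ (hset n)).compl
        _ ≤ c * P E + ∫⁻ ω in Eᶜ, Z n ω ∂P := by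
            exact add_le_add_right (hsuper n _ (hset n).compl) _
        _ ≤ _ := ih
  have hunion : {ω | ∃ t, c ≤ Z t ω} = ⋃ n, {ω | ∃ t ≤ n, c ≤ Z t ω} := by
    ext ω
    simp only [Set.mem_ofPred_eq, Set.mem_iUnion]
    exact ⟨fun ⟨t, h⟩ => ⟨t, t, le_rfl, h⟩, fun ⟨_, t, _, h⟩ => ⟨t, h⟩⟩
  have hmono : Monotone fun n => {ω | ∃ t ≤ n, c ≤ Z t ω} :=
    fun n n' hn ω ⟨t, ht, h⟩ => ⟨t, ht.trans hn, h⟩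
  rw [hunion, hmono.measure_iUnion, ENNReal.mul_iSup]
  exact iSup_le fun n => le_self_add.trans (key n)

/-! ### The mixture martingale -/

/-- The sum of the noise terms of the samples of each arm in the first `t` rounds. -/
noncomputable def noiseSum {d M : ℕ} (μ : Means d M) (a : ℕ → Fin M)
    (x : ℕ → EuclideanSpace ℝ (Fin d)) (t : ℕ) (m : Fin M) : EuclideanSpace ℝ (Fin d) :=
  ∑ s ∈ Finset.range t, if a s = m then x s - μ (a s) else 0

/-- The likelihood ratio of the mixture over all instances, with independent standard Gaussian
perturbations of the means, against the instance `μ`. -/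
noncomputable def mixture {d M : ℕ} (μ : Means d M) (a : ℕ → Fin M)
    (x : ℕ → EuclideanSpace ℝ (Fin d)) (t : ℕ) : ℝ :=
  ∏ m, √((pulls a t m + 1 : ℝ)⁻¹) ^ d *
    Real.exp (‖noiseSum μ a x t m‖ ^ 2 / (2 * (pulls a t m + 1)))

lemma mixture_nonneg {d M : ℕ} (μ : Means d M) (a : ℕ → Fin M)
    (x : ℕ → EuclideanSpace ℝ (Fin d)) (t : ℕ) : 0 ≤ mixture μ a x t :=
  Finset.prod_nonneg fun _ _ => by positivity

lemma mixture_pos {d M : ℕ} (μ : Means d M) (a : ℕ → Fin M)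
    (x : ℕ → EuclideanSpace ℝ (Fin d)) (t : ℕ) : 0 < mixture μ a x t :=
  Finset.prod_pos fun _ _ => by positivity

lemma mixture_zero {d M : ℕ} (μ : Means d M) (a : ℕ → Fin M)
    (x : ℕ → EuclideanSpace ℝ (Fin d)) : mixture μ a x 0 = 1 := by
  simp [mixture, noiseSum, pulls]

/-- Only the factor of the pulled arm changes. The prior acts as one extra observation, whence the
argument `pulls + 1`. -/
lemma mixture_succ {d M : ℕ} (μ : Means d M) (a : ℕ → Fin M)
    (x : ℕ → EuclideanSpace ℝ (Fin d)) (t : ℕ) :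
    mixture μ a x (t + 1) = mixture μ a x t *
      mixtureRatio (pulls a t (a t) + 1) (noiseSum μ a x t (a t)) (x t - μ (a t)) := by
  unfold mixture
  rw [← Finset.mul_prod_erase _ _ (Finset.mem_univ (a t)),
    ← Finset.mul_prod_erase (a := a t) Finset.univ (fun m => √((pulls a t m + 1 : ℝ)⁻¹) ^ d *
    Real.exp (‖noiseSum μ a x t m‖ ^ 2 / (2 * (pulls a t m + 1)))) (Finset.mem_univ _)]
  refine (congrArg₂ (· * ·) ?_ ?_).trans (mul_right_comm _ _ _)
  · rw [mixtureRatio, mul_mul_mul_comm, ← mul_pow, ← Real.sqrt_mul (by positivity),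
      ← Real.exp_add]
    congr 1
    · congr 2
      rw [pulls_succ]
      push_cast
      simp only [if_true]
      field_simp
    · congr 1
      rw [pulls_succ, noiseSum, Finset.sum_range_succ, ← noiseSum]
      push_cast
      simp only [if_true]
      ring
  · refine Finset.prod_congr rfl fun m hm => ?_
    have hne : a t ≠ m := (Finset.ne_of_mem_erase hm).symm
    rw [pulls_succ, noiseSum, Finset.sum_range_succ, ← noiseSum]
    simp [hne]

lemma log_mixture {d M : ℕ} (μ : Means d M) (a : ℕ → Fin M)
    (x : ℕ → EuclideanSpace ℝ (Fin d)) (t : ℕ) :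
    Real.log (mixture μ a x t) = ∑ m, (‖noiseSum μ a x t m‖ ^ 2 / (2 * (pulls a t m + 1)) -
      d / 2 * Real.log (pulls a t m + 1)) := by
  rw [mixture, Real.log_prod (fun m _ => by positivity)]
  refine Finset.sum_congr rfl fun m _ => ?_
  rw [Real.log_mul (by positivity) (by positivity), Real.log_exp, Real.log_pow,
    Real.log_sqrt (by positivity), Real.log_inv]
  ring

lemma measurable_pulls {Ω : Type*} [mΩ : MeasurableSpace Ω] {M : ℕ} {A : ℕ → Ω → Fin M} {t : ℕ}
    (hA : ∀ s < t, Measurable (A s)) (m : Fin M) :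
    Measurable fun ω => pulls (fun s => A s ω) t m := by
  simp only [pulls, Finset.card_filter]
  refine Finset.measurable_sum _ fun s hs => ?_
  exact Measurable.ite (hA s (Finset.mem_range.1 hs) (measurableSet_singleton m))
    measurable_const measurable_const

lemma measurable_noiseSum {Ω : Type*} [mΩ : MeasurableSpace Ω] {d M : ℕ} (μ : Means d M)
    {A : ℕ → Ω → Fin M} {X : ℕ → Ω → EuclideanSpace ℝ (Fin d)} {t : ℕ}
    (hA : ∀ s < t, Measurable (A s)) (hX : ∀ s < t, Measurable (X s)) (m : Fin M) :
    Measurable fun ω => noiseSum μ (fun s => A s ω) (fun s => X s ω) t m := by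
  refine Finset.measurable_sum _ fun s hs => ?_
  have hs := Finset.mem_range.1 hs
  exact Measurable.ite (hA s hs (measurableSet_singleton m))
    ((hX s hs).sub ((measurable_of_countable μ).comp (hA s hs))) measurable_const

lemma measurable_mixture {Ω : Type*} [mΩ : MeasurableSpace Ω] {d M : ℕ} (μ : Means d M)
    {A : ℕ → Ω → Fin M} {X : ℕ → Ω → EuclideanSpace ℝ (Fin d)} {t : ℕ}
    (hA : ∀ s < t, Measurable (A s)) (hX : ∀ s < t, Measurable (X s)) :
    Measurable fun ω => mixture μ (fun s => A s ω) (fun s => X s ω) t := by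
  refine Finset.measurable_prod _ fun m _ => ?_
  have h₁ : Measurable fun ω => (pulls (fun s => A s ω) t m : ℝ) :=
    (measurable_of_countable _).comp (measurable_pulls hA m)
  have h₂ := measurable_noiseSum μ hA hX m
  fun_prop

lemma measurable_apply_of_countable {Ω ι β : Type*} [mΩ : MeasurableSpace Ω] [MeasurableSpace ι]
    [Countable ι] [MeasurableSingletonClass ι] [MeasurableSpace β] {f : Ω → ι → β} {g : Ω → ι}
    (hf : ∀ i, Measurable fun ω => f ω i) (hg : Measurable g) : Measurable fun ω => f ω (g ω) :=
  (measurable_from_prod_countable_left (f := fun p : (ι → β) × ι => p.1 p.2)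
    fun i => measurable_pi_apply i).comp ((measurable_pi_lambda _ hf).prodMk hg)

/-- Integrating out a variable that is independent of the past. -/
lemma lintegral_indep {Ω β γ : Type*} {m mΩ : MeasurableSpace Ω} [MeasurableSpace β]
    [MeasurableSpace γ] (P : Measure Ω) [IsProbabilityMeasure P] (hm : m ≤ mΩ) {W : Ω → β}
    {Z : Ω → γ} (hW : Measurable[m] W) (hZ : Measurable Z)
    (hind : Indep (MeasurableSpace.comap Z inferInstance) m P) {f : β → γ → ℝ≥0∞}
    (hf : Measurable (Function.uncurry f)) :
    ∫⁻ ω, f (W ω) (Z ω) ∂P = ∫⁻ ω, ∫⁻ z, f (W ω) z ∂(P.map Z) ∂P := by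
  have hW' : Measurable W := hW.mono hm le_rfl
  have hWZ : IndepFun W Z P :=
    (IndepFun_iff_Indep _ _ _).2 (indep_of_indep_of_le_left hind.symm hW.comap_le)
  have hmap := (indepFun_iff_map_prod_eq_prod_map_map hW'.aemeasurable hZ.aemeasurable).1 hWZ
  have : IsProbabilityMeasure (P.map Z) := Measure.isProbabilityMeasure_map hZ.aemeasurable
  calc ∫⁻ ω, f (W ω) (Z ω) ∂P
      = ∫⁻ p, Function.uncurry f p ∂(P.map fun ω => (W ω, Z ω)) :=
        (lintegral_map hf (hW'.prodMk hZ)).symm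
    _ = ∫⁻ b, ∫⁻ z, f b z ∂(P.map Z) ∂(P.map W) := by
        rw [hmap, lintegral_prod _ hf.aemeasurable]; rfl
    _ = _ := lintegral_map hf.lintegral_prod_right' hW'

/-- The martingale property: the growth factor depends on the past only through the count and noise
sum of the chosen arm, and integrates to 1 against the fresh independent noise. -/
lemma IsGaussianBandit.setLIntegral_mixture_succ {d M : ℕ} {Ω : Type*} [mΩ : MeasurableSpace Ω]
    {P : Measure Ω} [IsProbabilityMeasure P] {μ : Means d M} {ℱ : Filtration ℕ mΩ}
    {A : ℕ → Ω → Fin M} {X : ℕ → Ω → EuclideanSpace ℝ (Fin d)} (h : IsGaussianBandit P μ ℱ A X)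
    (t : ℕ) (B : Set Ω) (hB : MeasurableSet[ℱ t] B) :
    ∫⁻ ω in B, ENNReal.ofReal (mixture μ (fun s => A s ω) (fun s => X s ω) (t + 1)) ∂P =
      ∫⁻ ω in B, ENNReal.ofReal (mixture μ (fun s => A s ω) (fun s => X s ω) t) ∂P := by
  have hA : ∀ s ≤ t, Measurable[ℱ t] (A s) := fun s hs =>
    (h.measurable_arm s).mono (ℱ.mono hs) le_rfl
  have hX : ∀ s < t, Measurable[ℱ t] (X s) := fun s hs =>
    (h.measurable_sample s).mono (ℱ.mono hs) le_rfl
  have hZ : Measurable fun ω => X t ω - μ (A t ω) :=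
    ((h.measurable_sample t).mono (ℱ.le _) le_rfl).sub
      ((measurable_of_countable μ).comp ((h.measurable_arm t).mono (ℱ.le _) le_rfl))
  let V : Ω → ℝ≥0∞ :=
    B.indicator fun ω => ENNReal.ofReal (mixture μ (fun s => A s ω) (fun s => X s ω) t)
  let W : Ω → ℝ≥0∞ × ℕ × EuclideanSpace ℝ (Fin d) := fun ω =>
    (V ω, pulls (fun s => A s ω) t (A t ω),
      noiseSum μ (fun s => A s ω) (fun s => X s ω) t (A t ω))
  let f : ℝ≥0∞ × ℕ × EuclideanSpace ℝ (Fin d) → EuclideanSpace ℝ (Fin d) → ℝ≥0∞ :=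
    fun p z => p.1 * ENNReal.ofReal (mixtureRatio (p.2.1 + 1) p.2.2 z)
  have hV : Measurable[ℱ t] V :=
    (measurable_mixture (mΩ := ℱ t) μ (fun s hs => hA s hs.le) hX).ennreal_ofReal.indicator hB
  have hW : Measurable[ℱ t] W := by
    refine hV.prodMk (Measurable.prodMk ?_ ?_)
    · exact measurable_apply_of_countable (mΩ := ℱ t)
        (fun m => measurable_pulls (mΩ := ℱ t) (fun s hs => hA s (le_of_lt hs)) m) (hA t le_rfl)
    · exact measurable_apply_of_countable (mΩ := ℱ t)
        (fun m => measurable_noiseSum (mΩ := ℱ t) μ (fun s hs => hA s (le_of_lt hs)) hX m)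
        (hA t le_rfl)
  have hf : Measurable (Function.uncurry f) := by
    have hcast : Measurable fun p : (ℝ≥0∞ × ℕ × EuclideanSpace ℝ (Fin d)) ×
        EuclideanSpace ℝ (Fin d) => (p.1.2.1 : ℝ) :=
      (measurable_of_countable fun n : ℕ => (n : ℝ)).comp (by fun_prop)
    simp only [Function.uncurry_def, f, mixtureRatio]
    fun_prop
  have hBm : MeasurableSet B := ℱ.le t _ hB
  rw [← lintegral_indicator hBm, ← lintegral_indicator hBm]
  calc _ = ∫⁻ ω, f (W ω) (X t ω - μ (A t ω)) ∂P := by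
        refine lintegral_congr fun ω => ?_
        by_cases hω : ω ∈ B
        · simp only [f, W, V, Set.indicator_of_mem hω]
          rw [mixture_succ, ENNReal.ofReal_mul (mixture_nonneg _ _ _ _)]
        · simp only [f, W, V, Set.indicator_of_notMem hω, zero_mul]
    _ = ∫⁻ ω, ∫⁻ z, f (W ω) z ∂(P.map fun ω => X t ω - μ (A t ω)) ∂P :=
        lintegral_indep P (ℱ.le t) hW hZ (h.indep_noise t) hf
    _ = ∫⁻ ω, V ω ∂P := by
        refine lintegral_congr fun ω => ?_
        simp only [f]
        rw [h.map_noise, lintegral_const_mul _ (by unfold mixtureRatio; fun_prop),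
          lintegral_mixtureRatio (by positivity), mul_one]

lemma IsGaussianBandit.measure_exists_le_mixture {d M : ℕ} {Ω : Type*} [mΩ : MeasurableSpace Ω]
    {P : Measure Ω} [IsProbabilityMeasure P] {μ : Means d M} {ℱ : Filtration ℕ mΩ}
    {A : ℕ → Ω → Fin M} {X : ℕ → Ω → EuclideanSpace ℝ (Fin d)} (h : IsGaussianBandit P μ ℱ A X)
    {c : ℝ} (hc : 0 < c) :
    P {ω | ∃ t, c⁻¹ ≤ mixture μ (fun s => A s ω) (fun s => X s ω) t} ≤ ENNReal.ofReal c := by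
  have hv := ville P ℱ
    (fun t ω => ENNReal.ofReal (mixture μ (fun s => A s ω) (fun s => X s ω) t))
    (fun t => (measurable_mixture (mΩ := ℱ t) μ
      (fun s hs => (h.measurable_arm s).mono (ℱ.mono (le_of_lt hs)) le_rfl)
      (fun s hs => (h.measurable_sample s).mono (ℱ.mono hs) le_rfl)).ennreal_ofReal)
    (fun t B hB => (h.setLIntegral_mixture_succ t B hB).le) (ENNReal.ofReal c⁻¹)
  simp only [ENNReal.ofReal_le_ofReal_iff (mixture_nonneg _ _ _ _), mixture_zero,
    ENNReal.ofReal_one, lintegral_const, measure_univ, mul_one] at hv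
  rw [ENNReal.ofReal_inv_of_pos hc, mul_comm, ← div_eq_mul_inv,
    ENNReal.div_le_iff (by simpa using hc) (by simp), one_mul] at hv
  exact hv

/-- For every `ε > 0` an unbounded path exceeds `ε⁻¹`, which has probability at most `ε`. -/
lemma IsGaussianBandit.ae_mixture_le {d M : ℕ} {Ω : Type*} [mΩ : MeasurableSpace Ω]
    {P : Measure Ω} [IsProbabilityMeasure P] {μ : Means d M} {ℱ : Filtration ℕ mΩ}
    {A : ℕ → Ω → Fin M} {X : ℕ → Ω → EuclideanSpace ℝ (Fin d)}
    (h : IsGaussianBandit P μ ℱ A X) :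
    ∀ᵐ ω ∂P, ∃ b, ∀ t, mixture μ (fun s => A s ω) (fun s => X s ω) t ≤ b := by
  rw [ae_iff]
  refine le_antisymm (ENNReal.le_of_forall_pos_le_add fun ε hε _ => ?_) zero_le
  rw [zero_add]
  refine (measure_mono fun ω hω => ?_).trans
    ((h.measure_exists_le_mixture (c := ε) hε).trans (by simp))
  simp only [Set.mem_ofPred_eq, not_exists, not_forall, not_le] at hω ⊢
  obtain ⟨t, ht⟩ := hω (ε : ℝ)⁻¹
  exact ⟨t, ht.le⟩

/-! ### The stopping rule -/

lemma noiseSum_eq {d M : ℕ} (μ : Means d M) (a : ℕ → Fin M)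
    (x : ℕ → EuclideanSpace ℝ (Fin d)) (t : ℕ) (m : Fin M) :
    noiseSum μ a x t m = (pulls a t m : ℝ) • (empMean a x t m - μ m) := by
  have h₁ : noiseSum μ a x t m =
      ∑ s ∈ (Finset.range t).filter (fun s => a s = m), x s - (pulls a t m : ℝ) • μ m := by
    rw [noiseSum, ← Finset.sum_filter, Finset.sum_sub_distrib]
    congr 1
    rw [Finset.sum_congr rfl (g := fun _ => μ m) fun s hs => by rw [(Finset.mem_filter.1 hs).2],
      Finset.sum_const, pulls, Nat.cast_smul_eq_nsmul]
  rw [h₁, smul_sub]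
  congr 1
  -- For an arm without pulls both sides vanish, whatever the default value of `empMean`.
  by_cases hN : pulls a t m = 0
  · rw [hN, Nat.cast_zero, zero_smul]
    rw [pulls, Finset.card_eq_zero] at hN
    rw [hN, Finset.sum_empty]
  · rw [empMean, smul_smul, mul_inv_cancel₀ (by exact_mod_cast hN), one_smul]

lemma threshold_eq {M d : ℕ} {δ : ℝ} (hδ : 0 < δ) (a : ℕ → Fin M) (t : ℕ) :
    threshold d δ a t = ∑ m, d * Real.log (pulls a t m + 1) - 2 * Real.log δ := by
  rw [threshold, Real.log_div (by positivity) hδ.ne', Real.log_sqrt (by positivity),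
    Real.log_prod (fun m _ => by positivity)]
  simp only [Real.log_pow]
  ring

lemma stopTime_lt_top {d M K : ℕ} {C : Means d M → Fin M → Fin K} {δ : ℝ} {a : ℕ → Fin M}
    {x : ℕ → EuclideanSpace ℝ (Fin d)} {t : ℕ} (ht : 1 ≤ t)
    (h : ENNReal.ofReal (threshold d δ a t) ≤ glr C a x t) : stopTime C δ a x < ⊤ :=
  (iInf₂_le t ⟨ht, h⟩).trans_lt (ENat.natCast_lt_top t)

lemma stopTime_spec {d M K : ℕ} {C : Means d M → Fin M → Fin K} {δ : ℝ} {a : ℕ → Fin M}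
    {x : ℕ → EuclideanSpace ℝ (Fin d)} (h : stopTime C δ a x < ⊤) :
    1 ≤ (stopTime C δ a x).toNat ∧ ENNReal.ofReal (threshold d δ a (stopTime C δ a x).toNat) ≤
      glr C a x (stopTime C δ a x).toNat := by
  classical
  have hex : ∃ t, 1 ≤ t ∧ ENNReal.ofReal (threshold d δ a t) ≤ glr C a x t := by
    by_contra! hcon
    refine h.ne (iInf₂_eq_top.2 fun t ht => absurd ht.2 (hcon t ht.1).not_ge)
  have heq : stopTime C δ a x = (Nat.find hex : ℕ∞) :=
    le_antisymm (iInf₂_le (Nat.find hex) (Nat.find_spec hex))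
      (le_iInf₂ fun t ht => Nat.cast_le.2 (Nat.find_min' hex ht))
  rw [heq]
  exact Nat.find_spec hex

lemma natCast_mul_ofReal {t : ℕ} (r : ℝ) :
    (t : ℝ≥0∞) * ENNReal.ofReal r = ENNReal.ofReal (t * r) := by
  rw [ENNReal.ofReal_mul (Nat.cast_nonneg t), ENNReal.ofReal_natCast]

/-- If the algorithm stops with a wrong clustering, the mixture martingale is large. -/
lemma inv_le_mixture_of_not_equivalent {d M K : ℕ} {C : Means d M → Fin M → Fin K} {δ : ℝ}
    (hδ : 0 < δ) {μ : Means d M} {a : ℕ → Fin M} {x : ℕ → EuclideanSpace ℝ (Fin d)} {t : ℕ}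
    (ht : 1 ≤ t) (hτ : ENNReal.ofReal (threshold d δ a t) ≤ glr C a x t)
    (hne : ¬ Equivalent (C (empMean a x t)) (C μ)) : δ⁻¹ ≤ mixture μ a x t := by
  have ht' : (t : ℝ) ≠ 0 := by positivity
  -- The clustering is wrong, so `μ` itself competes in the infimum defining `psi`.
  have hle : threshold d δ a t ≤
      1 / 2 * ∑ m, (pulls a t m : ℝ) * ‖empMean a x t m - μ m‖ ^ 2 := by
    refine (ENNReal.ofReal_le_ofReal_iff (by positivity)).1 (hτ.trans ?_)
    calc glr C a x t ≤ (t : ℝ≥0∞) * ENNReal.ofReal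
          (1 / 2 * ∑ m, (pulls a t m : ℝ) / t * ‖μ m - empMean a x t m‖ ^ 2) := by
          unfold glr
          gcongr
          exact iInf₂_le μ fun h => hne h.symm
      _ = _ := by
          rw [natCast_mul_ofReal]
          congr 1
          rw [mul_left_comm, Finset.mul_sum]
          congr 1
          refine Finset.sum_congr rfl fun m _ => ?_
          rw [norm_sub_rev]
          field_simp
  rw [← Real.log_le_log_iff (by positivity) (mixture_pos _ _ _ _), Real.log_inv, log_mixture,
    Finset.sum_sub_distrib]
  rw [threshold_eq hδ] at hle
  -- `N² / (2(N + 1)) ≥ N / 4` for every natural `N`. The factor 2 lost against `N / 2` is the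
  -- factor 2 in front of the logarithm in `threshold`.
  have h₁ : 1 / 4 * ∑ m, (pulls a t m : ℝ) * ‖empMean a x t m - μ m‖ ^ 2 ≤
      ∑ m, ‖noiseSum μ a x t m‖ ^ 2 / (2 * (pulls a t m + 1)) := by
    rw [Finset.mul_sum]
    refine Finset.sum_le_sum fun m _ => ?_
    rw [noiseSum_eq, norm_smul, mul_pow, Real.norm_natCast, le_div_iff₀ (by positivity)]
    have hN : (pulls a t m : ℝ) ≤ (pulls a t m : ℝ) ^ 2 := by
      exact_mod_cast Nat.le_self_pow two_ne_zero _
    nlinarith [sq_nonneg ‖empMean a x t m - μ m‖]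
  have h₂ : ∑ m, (d : ℝ) / 2 * Real.log (pulls a t m + 1) =
      1 / 2 * ∑ m, d * Real.log (pulls a t m + 1) := by
    rw [Finset.mul_sum]
    exact Finset.sum_congr rfl fun m _ => by ring
  linarith

/-- The logarithm is eventually dominated by the guaranteed number of pulls. -/
lemma eventually_log_lt_sqrt {M : ℕ} (hM : 0 < M) (c₁ c₂ : ℝ) {ε : ℝ} (hε : 0 < ε) :
    ∀ᶠ t : ℕ in Filter.atTop, c₁ + c₂ * Real.log (t + 1) < ε * (√(t / (2 * M)) - 1) := by
  have hlog : Real.log =o[Filter.atTop] fun y : ℝ => y ^ (1 / 2 : ℝ) :=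
    isLittleO_log_rpow_atTop (by norm_num)
  have hconst : (fun _ : ℝ => c₁ + ε) =o[Filter.atTop] fun y : ℝ => y ^ (1 / 2 : ℝ) :=
    Asymptotics.isLittleO_const_left.2 <| Or.inr <|
      tendsto_norm_atTop_atTop.comp (tendsto_rpow_atTop (by norm_num))
  have hsum := hconst.add (hlog.const_mul_left c₂)
  -- `4M` comes from `t + 1 ≤ 2t`, the extra 2 makes the final inequality strict, and the `ε` added
  -- to `c₁` absorbs the `- 1`.
  have hη : 0 < ε / (2 * √(4 * M)) := by positivity
  have hev := (Filter.tendsto_atTop_add_const_right _ 1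
    (tendsto_natCast_atTop_atTop (R := ℝ))).eventually (hsum.bound hη)
  filter_upwards [hev, Filter.eventually_ge_atTop 1] with t ht ht₁
  rw [← Real.sqrt_eq_rpow, Real.norm_eq_abs, Real.norm_of_nonneg (Real.sqrt_nonneg _)] at ht
  have ht₁' : (1 : ℝ) ≤ t := by exact_mod_cast ht₁
  have hM' : (0 : ℝ) < M := by exact_mod_cast hM
  have h₁ : √((t : ℝ) + 1) / √(4 * M) ≤ √(t / (2 * M)) := by
    rw [← Real.sqrt_div (by positivity)]
    refine Real.sqrt_le_sqrt ?_
    rw [div_le_div_iff₀ (by positivity) (by positivity)]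
    nlinarith
  have h₂ : ε / (2 * √(4 * M)) * √((t : ℝ) + 1) = ε * (√((t : ℝ) + 1) / √(4 * M)) / 2 := by
    field_simp
  have h₃ : 0 < ε * (√((t : ℝ) + 1) / √(4 * M)) := by positivity
  have h₄ := mul_le_mul_of_nonneg_left h₁ hε.le
  linarith [le_abs_self (c₁ + ε + c₂ * Real.log (t + 1))]

lemma FollowsATBOC.sqrt_sub_one_le_pulls {d M K : ℕ} {C : Means d M → Fin M → Fin K}
    {a : ℕ → Fin M} {x : ℕ → EuclideanSpace ℝ (Fin d)} {w : ℕ → Fin M → ℝ}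
    (h : FollowsATBOC C a x w) (t : ℕ) (m : Fin M) :
    √(t / (2 * M)) - 1 ≤ (pulls a t m : ℝ) := by
  have hM : (0 : ℝ) < M := by exact_mod_cast Fin.pos m
  have hfloor : (⌊√((t : ℝ) / (2 * M))⌋₊ : ℝ) ≤ √(t / (2 * M)) :=
    Nat.floor_le (Real.sqrt_nonneg _)
  have hk : 2 * M * ⌊√((t : ℝ) / (2 * M))⌋₊ ^ 2 ≤ t := by
    have h₁ : (⌊√((t : ℝ) / (2 * M))⌋₊ : ℝ) ^ 2 ≤ t / (2 * M) := by
      refine (pow_le_pow_left₀ (by positivity) hfloor 2).trans_eq (Real.sq_sqrt (by positivity))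
    rw [le_div_iff₀ (by positivity)] at h₁
    have h₂ : (2 * M * ⌊√((t : ℝ) / (2 * M))⌋₊ ^ 2 : ℝ) ≤ t := by linarith
    exact_mod_cast h₂
  have h₃ : (⌊√((t : ℝ) / (2 * M))⌋₊ : ℝ) ≤ pulls a t m := by exact_mod_cast h.le_pulls m hk
  linarith [Nat.lt_floor_add_one √((t : ℝ) / (2 * M))]

/-- The algorithm stops along each sequence of pulls on which the mixture martingale is bounded. -/
lemma FollowsATBOC.stopTime_lt_top {d M K : ℕ} {C : Means d M → Fin M → Fin K}
    (hC : IsSlinkMap C) {μ : Means d M} (hμ : dIntra μ (C μ) < dInter μ (C μ)) {δ : ℝ}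
    (hδ : 0 < δ) {a : ℕ → Fin M} {x : ℕ → EuclideanSpace ℝ (Fin d)} {w : ℕ → Fin M → ℝ}
    (h : FollowsATBOC C a x w) {b : ℝ} (hb : ∀ t, mixture μ a x t ≤ b) :
    stopTime C δ a x < ⊤ := by
  have hM : 0 < M := Fin.pos (a 0)
  obtain ⟨ε, hε, hψ⟩ := hC.exists_le_psi hμ
  have hε₂ : 0 < ε ^ 2 := by positivity
  -- `ht₂` says that every arm has been pulled, `ht₃` brings the estimates within `ε` of `μ`, and
  -- `ht₄` puts the threshold below the lower bound `ε² q / 2` of the statistic.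
  obtain ⟨t, ht₁, ht₂, ht₃, ht₄⟩ := ((Filter.eventually_ge_atTop 1).and <|
    (eventually_log_lt_sqrt hM 0 0 one_pos).and <|
    (eventually_log_lt_sqrt hM (4 * Real.log b) (4 * (M * (d / 2))) hε₂).and
      (eventually_log_lt_sqrt hM (-2 * Real.log δ) (M * d)
        (show 0 < ε ^ 2 / 2 by positivity))).exists
  set q : ℝ := √(t / (2 * M)) - 1 with hq
  have hq₀ : 0 < q := by linarith
  have hqN : ∀ m, q ≤ (pulls a t m : ℝ) := h.sqrt_sub_one_le_pulls t
  have hlogN : ∀ m, Real.log (pulls a t m + 1) ≤ Real.log (t + 1) := fun m => by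
    have : (pulls a t m : ℝ) ≤ t := by exact_mod_cast pulls_le a t m
    exact Real.log_le_log (by positivity) (by linarith)
  have ht₀ : (0 : ℝ) < t := by exact_mod_cast ht₁
  -- The bound on `mixture` plays the role of a law of large numbers under adaptive sampling: each
  -- term of `log_mixture` is at most `log b` plus the logarithmic penalties.
  have hclose : ∀ m, ‖empMean a x t m - μ m‖ < ε := fun m => by
    have hlog : Real.log (mixture μ a x t) ≤ Real.log b :=
      Real.log_le_log (mixture_pos _ _ _ _) (hb t)
    rw [log_mixture, Finset.sum_sub_distrib] at hlog
    have h₁ := Finset.single_le_sum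
      (f := fun m => ‖noiseSum μ a x t m‖ ^ 2 / (2 * ((pulls a t m : ℝ) + 1)))
      (fun m _ => by positivity) (Finset.mem_univ m)
    have h₂ : ∑ m, (d : ℝ) / 2 * Real.log (pulls a t m + 1) ≤
        M * (d / 2 * Real.log (t + 1)) := by
      refine (Finset.sum_le_sum fun m _ =>
        mul_le_mul_of_nonneg_left (hlogN m) (by positivity)).trans ?_
      simp
    have h₃ : ‖noiseSum μ a x t m‖ ^ 2 / (2 * ((pulls a t m : ℝ) + 1)) < ε ^ 2 * q / 4 := by
      linarith
    have hN₀ : (0 : ℝ) < pulls a t m := hq₀.trans_le (hqN m)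
    have hN₁ : (1 : ℝ) ≤ pulls a t m := by exact_mod_cast Nat.cast_pos.1 hN₀
    rw [noiseSum_eq, norm_smul, mul_pow, Real.norm_natCast, div_lt_iff₀ (by positivity)] at h₃
    have h₄ : (pulls a t m : ℝ) ^ 2 * ‖empMean a x t m - μ m‖ ^ 2 <
        (pulls a t m : ℝ) ^ 2 * ε ^ 2 := by
      have h₅ : q * (2 * ((pulls a t m : ℝ) + 1)) ≤ 4 * (pulls a t m : ℝ) ^ 2 := by
        nlinarith [hqN m]
      nlinarith
    exact lt_of_pow_lt_pow_left₀ 2 hε.le (lt_of_mul_lt_mul_left h₄ (by positivity))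
  refine BanditClustering.stopTime_lt_top ht₁ ?_
  calc ENNReal.ofReal (threshold d δ a t) ≤ ENNReal.ofReal (t * (1 / 2 * (q / t * ε ^ 2))) := by
        refine ENNReal.ofReal_le_ofReal ?_
        rw [threshold_eq hδ]
        have h₁ : ∑ m, (d : ℝ) * Real.log (pulls a t m + 1) ≤ M * (d * Real.log (t + 1)) := by
          refine (Finset.sum_le_sum fun m _ =>
            mul_le_mul_of_nonneg_left (hlogN m) (by positivity)).trans ?_
          simp
        have h₂ : (t : ℝ) * (1 / 2 * (q / t * ε ^ 2)) = ε ^ 2 / 2 * q := by field_simp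
        rw [h₂]
        linarith
    _ = (t : ℝ≥0∞) * ENNReal.ofReal (1 / 2 * (q / t * ε ^ 2)) := (natCast_mul_ofReal _).symm
    _ ≤ glr C a x t := by
        unfold glr
        gcongr
        exact hψ _ hclose _ _ (by positivity) fun m => by gcongr; exact hqN m

end BanditClustering

open BanditClustering in
theorem theorem2 {d M K : ℕ} (δ : ℝ) (hδ₀ : 0 < δ) (hδ₁ : δ < 1)
    (C : Means d M → Fin M → Fin K) (hC : IsSlinkMap C)
    (μ : Means d M) (hμ : dIntra μ (C μ) < dInter μ (C μ))
    {Ω : Type*} [mΩ : MeasurableSpace Ω] (P : Measure Ω) [IsProbabilityMeasure P]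
    (ℱ : Filtration ℕ mΩ) (A : ℕ → Ω → Fin M) (X : ℕ → Ω → EuclideanSpace ℝ (Fin d))
    (w : ℕ → Ω → Fin M → ℝ)
    (hbandit : IsGaussianBandit P μ ℱ A X)
    (halg : ∀ ω, FollowsATBOC C (fun t => A t ω) (fun t => X t ω) (fun t => w t ω)) :
    (∀ᵐ ω ∂P, stopTime C δ (fun t => A t ω) (fun t => X t ω) < ⊤) ∧
    P {ω | ¬ Equivalent
        (C (empMean (fun t => A t ω) (fun t => X t ω)
          (stopTime C δ (fun t => A t ω) (fun t => X t ω)).toNat))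
        (C μ)} ≤ ENNReal.ofReal δ := by
  have hτ : ∀ᵐ ω ∂P, stopTime C δ (fun t => A t ω) (fun t => X t ω) < ⊤ := by
    filter_upwards [hbandit.ae_mixture_le] with ω ⟨b, hb⟩
    exact (halg ω).stopTime_lt_top hC hμ hδ₀ hb
  -- The error event need not be measurable, as ties in `C` are arbitrary; almost-everywhere
  -- inclusion in the crossing event suffices, and discards the paths with infinite stopping time.
  refine ⟨hτ, (measure_mono_ae ?_).trans (hbandit.measure_exists_le_mixture hδ₀)⟩
  filter_upwards [hτ] with ω hω hne
  exact ⟨_, inv_le_mixture_of_not_equivalent hδ₀ (stopTime_spec hω).1 (stopTime_spec hω).2 hne⟩
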